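/- Let $X$ be a complete smooth split toric variety over $\mathbb{Q}$ of dimension $n\ge 1$, with fan $\Sigma$ in $N_{\mathbb R}$ ($N\cong\mathbb Z^n$ the lattice of cocharacters, $M$ its dual), rays $\rho_1,\dots,\rho_s$ with primitive generators $\nu_1,\dots,\nu_s\in N$, set of maximal cones $\Sigma_{\max}$, and torus invariant prime divisors $D_1,\dots,D_s$. Then $\mathrm{Pic}(X)_{\mathbb R}=\bigl(\bigoplus_{i}\mathbb R D_i\bigr)/M_{\mathbb R}$, where $u\in M_{\mathbb R}$ is sent to $\sum_i u(\nu_i)D_i$, and $\mathrm{Eff}(X)\subseteq \mathrm{Pic}(X)_{\mathbb R}$ is the cone generated by $[D_1],\dots,[D_s]$. Let $m_1,\dots,m_s$ be positive integers, $K_X=-\sum_i D_i$ and $\Delta=\sum_i(1-\frac1{m_i})D_i$, and assume that $-(K_X+\Delta)$ is ample. Let $L=\sum_i a_iD_i$ be a big and semiample $\mathbb Q$-divisor. For $\sigma\in\Sigma_{\max}$ let $u_{\sigma,L}\in M_{\mathbb R}$ be determined by $u_{\sigma,L}(\nu_j)=a_j$ for all $j$ with $\rho_j\subseteq\sigma$,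 and put $\alpha_{i,\sigma}=a_i-u_{\sigma,L}(\nu_i)$. Assume that for every $i$ there is $\sigma\in\Sigma_{\max}$ with $\alpha_{i,\sigma}>0$. Let $$a(L)=\inf\{t\in\mathbb R:\ t[L]+[K_X+\Delta]\in\mathrm{Eff}(X)\},$$ and let $b(L)$ be the codimension in $\mathrm{Pic}(X)_{\mathbb R}$ of the minimal face of $\mathrm{Eff}(X)$ containing $a(L)[L]+[K_X+\Delta]$. Let $$\widetilde P=\Bigl\{\mathbf t\in\mathbb R^s:\ t_i\ge 0\ \forall i,\ \ \sum_{i=1}^s\alpha_{i,\sigma}t_i\le 1\ \forall\sigma\in\Sigma_{\max}\Bigr\},$$ and let $\widetilde F$ be the face of $\widetilde P$ on which $\sum_{i=1}^s t_i/m_i$ attains its maximum over $\widetilde P$. Identify $\mathbb R^s$ with the space of linear functions on $\bigoplus_i\mathbb RD_i$ by $\mathbf t(D_i)=t_i$; the dual space of $\mathrm{Pic}(X)_{\mathbb R}$ is thereby a subspace $\widetilde H\subseteq\mathbb R^s$. Then the infimum $a(L)$ is a minimum, $\widetilde F$ is nonempty and contained in $\widetilde H$, and there is a smallest face $G$ of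 $\mathrm{Eff}(X)$ containing $a(L)[L]+[K_X+\Delta]$. The cone generated by $\widetilde F$ is the face dual to $G$: it is a face of the dual cone $\mathrm{Eff}(X)^\vee\subseteq\widetilde H$, and $$\mathrm{cone}(\widetilde F)=\mathrm{Eff}(X)^\vee\cap G^{\perp},\qquad G=\mathrm{Eff}(X)\cap\mathrm{cone}(\widetilde F)^{\perp}.$$ In particular, $b(L)=\dim\widetilde F+1$, so $\dim\widetilde F$, the exponent of $\log B$ suggested by the hyperbola method, equals the exponent $b(L)-1$ in the conjectured asymptotic $c\,B^{a(L)}(\log B)^{b(L)-1}$. -/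

import Mathlib

/-- The combinatorial datum of a complete smooth split toric variety `X` of dimension `n` with `s`
torus invariant prime divisors: a complete regular fan in `N_ℝ = ℝⁿ` for the lattice of
cocharacters `N = ℤⁿ`.  A cone of the fan is recorded by the set of indices of its rays, and the
fan by its maximal cones. -/
structure SmoothCompleteFan (n s : ℕ) where
  /-- the generator of `ρ i ∩ N`, for each of the `s` rays `ρ i` -/
  ray : Fin s → (Fin n → ℤ)
  /-- the index sets of the maximal cones -/
  maxCones : Finset (Finset (Fin s))
  /-- every ray is a ray of some maximal cone -/
  ray_mem : ∀ i, ∃ σ ∈ maxCones, i ∈ σ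
  /-- smoothness: the ray generators of a maximal cone are a `ℤ`-basis of `N` -/
  linearIndependent : ∀ σ ∈ maxCones, LinearIndependent ℤ (fun i : σ => ray i)
  span_eq_top : ∀ σ ∈ maxCones, Submodule.span ℤ (ray '' (σ : Set (Fin s))) = ⊤
  /-- two maximal cones meet in the cone spanned by their common rays, a face of both -/
  inter : ∀ σ ∈ maxCones, ∀ τ ∈ maxCones,
    PointedCone.hull ℝ ((fun i k => (ray i k : ℝ)) '' (σ : Set (Fin s))) ⊓
      PointedCone.hull ℝ ((fun i k => (ray i k : ℝ)) '' (τ : Set (Fin s))) =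
    PointedCone.hull ℝ ((fun i k => (ray i k : ℝ)) '' ((σ : Set (Fin s)) ∩ (τ : Set (Fin s))))
  /-- completeness: the maximal cones cover `N_ℝ` -/
  complete : ∀ v : Fin n → ℝ, ∃ σ ∈ maxCones,
    v ∈ PointedCone.hull ℝ ((fun i k => (ray i k : ℝ)) '' (σ : Set (Fin s)))

/-- The minimal face of the cone `C` that contains `x`: the intersection of all faces of `C`
that contain `x`. -/
def minimalFace {V : Type*} [AddCommGroup V] [Module ℝ V] (C : PointedCone ℝ V) (x : V) :
    PointedCone ℝ V :=
  sInf {G | G.IsFaceOf C ∧ x ∈ G}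

/-- The face `G` of the cone `C` in `V` and the face `G'` of the dual cone `Cᵛ` in the dual space
of `V` are dual to each other: `G' = Cᵛ ∩ G^⊥` and `G = C ∩ G'^⊥`. -/
def AreDualFaces {V : Type*} [AddCommGroup V] [Module ℝ V] (C G : PointedCone ℝ V)
    (G' : PointedCone ℝ (Module.Dual ℝ V)) : Prop :=
  G.IsFaceOf C ∧
  G'.IsFaceOf (PointedCone.dual (Module.Dual.eval ℝ V) (C : Set V)) ∧
  (∀ l : Module.Dual ℝ V, l ∈ G' ↔ (∀ x ∈ C, 0 ≤ l x) ∧ ∀ x ∈ G, l x = 0) ∧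
  (∀ x : V, x ∈ G ↔ x ∈ C ∧ ∀ l ∈ G', l x = 0)

/-- The dimension of a convex set: the dimension of its affine span. -/
noncomputable def affineDim {V : Type*} [AddCommGroup V] [Module ℝ V] (S : Set V) : ℕ :=
  Module.finrank ℝ (affineSpan ℝ S).direction

namespace SmoothCompleteFan

variable {n s : ℕ} (X : SmoothCompleteFan n s)

/-- The ray generator as a vector of `N_ℝ`. -/
def rayR (i : Fin s) : Fin n → ℝ := fun k => (X.ray i k : ℝ)

/-- For a maximal cone `σ` and real numbers `a j`, there is exactly one `u ∈ M_ℝ` with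
`u (ray j) = a j` for all rays of `σ`. -/
theorem existsUnique_character (σ : X.maxCones) (a : Fin s → ℝ) :
    ∃! u : Module.Dual ℝ (Fin n → ℝ), ∀ j ∈ σ.1, u (X.rayR j) = a j := by
  have hli := X.linearIndependent σ.1 σ.2
  have hsp := X.span_eq_top σ.1 σ.2
  have hr : Set.range (fun i : σ.1 => X.ray i) = X.ray '' (σ.1 : Set (Fin s)) := by
    ext v; simp
  let b : Module.Basis σ.1 ℤ (Fin n → ℤ) := Module.Basis.mk hli (by rw [hr, hsp])
  let f : (Fin n → ℤ) →ₗ[ℤ] ℝ := b.constr ℤ (fun j => a j.1)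
  have hcast : ∀ (u : Module.Dual ℝ (Fin n → ℝ)) (v : Fin n → ℤ),
      u (fun k => (v k : ℝ)) = ∑ k, (v k : ℝ) * u (Pi.single k 1) := by
    intro u v
    rw [LinearMap.pi_apply_eq_sum_univ u]
    refine Finset.sum_congr rfl fun k _ => ?_
    rw [smul_eq_mul]
    congr 2
    ext j
    simp [Pi.single_apply, eq_comm]
  refine ⟨∑ k, f (Pi.single k 1) • LinearMap.proj k, ?_, ?_⟩
  · intro j hj
    have h1 : f (X.ray j) = a j := by
      have hb : b ⟨j, hj⟩ = X.ray j := by simp [b]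
      rw [← hb]
      simp [f]
    rw [← h1, LinearMap.pi_apply_eq_sum_univ f (X.ray j)]
    simp only [LinearMap.sum_apply, LinearMap.smul_apply, LinearMap.proj_apply, smul_eq_mul, rayR]
    refine Finset.sum_congr rfl fun k _ => ?_
    rw [zsmul_eq_mul, mul_comm]
    congr 2
    ext j
    simp [Pi.single_apply, eq_comm]
  · intro u hu
    let g : (Fin n → ℤ) →ₗ[ℤ] ℝ :=
      { toFun := fun v => u (fun k => (v k : ℝ))
        map_add' := by
          intro v w
          rw [← map_add]
          congr 1
          ext k
          simp
        map_smul' := by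
          intro c v
          have : (fun k => ((c • v) k : ℝ)) = (c : ℝ) • (fun k => (v k : ℝ)) := by
            ext k; simp
          rw [this, map_smul]
          simp }
    have hgf : g = f := by
      refine b.ext fun j => ?_
      have hb : b j = X.ray j := by simp [b]
      have h2 : f (b j) = a j.1 := by simp [f]
      rw [h2, hb]
      exact hu j.1 j.2
    refine LinearMap.pi_ext' fun k => LinearMap.ext_ring ?_
    have h3 : g (Pi.single k 1) = f (Pi.single k 1) := by rw [hgf]
    have h4 : (fun j => ((Pi.single k (1 : ℤ) : Fin n → ℤ) j : ℝ)) = Pi.single k 1 := by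
      ext j
      by_cases h : j = k
      · subst h; simp
      · simp [h]
    have h5 : u (Pi.single k 1) = f (Pi.single k 1) := by
      rw [← h3, ← h4]
      rfl
    simp [h5, Pi.single_apply]

/-! ### Divisors

A torus invariant `ℚ`-divisor `∑ a i • D i` is the tuple of its coefficients `a : Fin s → ℚ`;
similarly for integral and for real coefficients.  A character in `M = Hom(N, ℤ)` has divisor
`∑ m (ray i) • D i`. -/

/-- The map `M_ℝ → ⊕ ℝ D i` that sends a character to its divisor. -/
def divR : Module.Dual ℝ (Fin n → ℝ) →ₗ[ℝ] (Fin s → ℝ) where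
  toFun u := fun i => u (X.rayR i)
  map_add' _ _ := rfl
  map_smul' _ _ := rfl

/-- `Pic(X)_ℝ`: torus invariant divisors with real coefficients modulo the image of `M_ℝ`. -/
abbrev PicR : Type := (Fin s → ℝ) ⧸ LinearMap.range X.divR

/-- The quotient map `φ : ⊕ ℝ D i → Pic(X)_ℝ`. -/
abbrev toPic : (Fin s → ℝ) →ₗ[ℝ] X.PicR := (LinearMap.range X.divR).mkQ

/-- The class in `Pic(X)_ℝ` of a torus invariant `ℚ`-divisor. -/
def cls (D : Fin s → ℚ) : X.PicR := X.toPic (fun i => (D i : ℝ))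

/-- The effective cone `Eff(X)`: the image in `Pic(X)_ℝ` of the cone of effective torus invariant
divisors. -/
def Eff : PointedCone ℝ X.PicR := (PointedCone.positive ℝ (Fin s → ℝ)).map X.toPic

/-- The characters `m ∈ M` that are global sections of `O(E)`, for an integral divisor `E`.  They
form a basis of `H⁰(X, O(E))`; the divisor of zeros of the section `m` is
`∑ (m (ray i) + E i) • D i`. -/
def sections (E : Fin s → ℤ) : Set (Module.Dual ℤ (Fin n → ℤ)) :=
  {m | ∀ i, 0 ≤ m (X.ray i) + E i}

/-- `E` is base point free: on each torus invariant affine chart `U_σ` (which meets exactly the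
`D i` with `i ∈ σ`) some section has no zero. -/
def IsBasePointFree (E : Fin s → ℤ) : Prop :=
  ∀ σ ∈ X.maxCones, ∃ m ∈ X.sections E, ∀ i ∈ σ, m (X.ray i) + E i = 0

/-- The `ℚ`-divisor `D` is semiample: a positive multiple is integral and base point free. -/
def IsSemiample (D : Fin s → ℚ) : Prop :=
  ∃ t : ℕ, 0 < t ∧ ∃ E : Fin s → ℤ, (∀ i, (E i : ℚ) = t * D i) ∧ X.IsBasePointFree E

/-- The `ℚ`-divisor `D` is ample: it has a positive integral multiple `E` such that each
torus invariant affine chart `U_σ` is the complement of the zeros of a section of a positive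
multiple of `E`. -/
def IsAmple (D : Fin s → ℚ) : Prop :=
  ∃ t : ℕ, 0 < t ∧ ∃ E : Fin s → ℤ, (∀ i, (E i : ℚ) = t * D i) ∧
    ∀ σ ∈ X.maxCones, ∃ k : ℕ, 0 < k ∧ ∃ m ∈ X.sections (k • E),
      ∀ i, m (X.ray i) + (k • E) i = 0 ↔ i ∈ σ

/-- The `ℚ`-divisor `D` is big: it has a positive integral multiple `E` such that
`dim H⁰(X, O(k E))` grows at least like a positive multiple of `k ^ dim X`. -/
def IsBig (D : Fin s → ℚ) : Prop :=
  ∃ t : ℕ, 0 < t ∧ ∃ E : Fin s → ℤ, (∀ i, (E i : ℚ) = t * D i) ∧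
    ∃ c : ℝ, 0 < c ∧ ∃ k₀ : ℕ, ∀ k : ℕ, k₀ ≤ k →
      c * (k : ℝ) ^ n ≤ ((X.sections (k • E)).ncard : ℝ)

/-- The element `u_{σ,D} ∈ M_ℝ`, determined by `u (ray j) = D j` for the rays of `σ`. -/
noncomputable def u (σ : X.maxCones) (D : Fin s → ℚ) : Module.Dual ℝ (Fin n → ℝ) :=
  (X.existsUnique_character σ (fun j => (D j : ℝ))).choose

/-- The coefficients `α_{i,σ}` of `D(σ) = D - ∑ u_{σ,D} (ray i) • D i`, the divisor equivalent to
`D` that is trivial on the chart `U_σ`. -/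
noncomputable def coeff (D : Fin s → ℚ) (σ : X.maxCones) (i : Fin s) : ℝ :=
  (D i : ℝ) - X.u σ D (X.rayR i)

/-! ### The orbifold divisor, `a(L)` and `b(L)` -/

/-- The `ℚ`-divisor `K_X + Δ`, where `K_X = -∑ D i` and `Δ = ∑ (1 - 1 / m i) • D i`. -/
def logCanonical {s : ℕ} (m : Fin s → ℕ) : Fin s → ℚ :=
  fun i => (-1) + (1 - 1 / (m i : ℚ))

/-- The set whose infimum is `a(L)`. -/
def adjointSet (m : Fin s → ℕ) (L : Fin s → ℚ) : Set ℝ :=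
  {t : ℝ | t • X.cls L + X.cls (logCanonical m) ∈ X.Eff}

/-- `a(L) = inf {t : t [L] + [K_X + Δ] ∈ Eff(X)}`. -/
noncomputable def a (m : Fin s → ℕ) (L : Fin s → ℚ) : ℝ := sInf (X.adjointSet m L)

/-- The class `a(L) [L] + [K_X + Δ]`. -/
noncomputable def adjointClass (m : Fin s → ℕ) (L : Fin s → ℚ) : X.PicR :=
  X.a m L • X.cls L + X.cls (logCanonical m)

/-- `b(L)`: the codimension in `Pic(X)_ℝ` of the minimal face of `Eff(X)` that contains
`a(L) [L] + [K_X + Δ]`. -/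
noncomputable def b (m : Fin s → ℕ) (L : Fin s → ℚ) : ℕ :=
  Module.finrank ℝ
    (X.PicR ⧸ Submodule.span ℝ (minimalFace X.Eff (X.adjointClass m L) : Set X.PicR))

/-! ### The polytope and its maximal face -/

/-- The polytope `P̃` in `ℝˢ`. -/
def polytope (L : Fin s → ℚ) : Set (Fin s → ℝ) :=
  {t | (∀ i, 0 ≤ t i) ∧ ∀ σ : X.maxCones, ∑ i, X.coeff L σ i * t i ≤ 1}

/-- The face `F̃` of `P̃` where `∑ t i / m i` attains its maximum. -/
def maximalFace (m : Fin s → ℕ) (L : Fin s → ℚ) : Set (Fin s → ℝ) :=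
  {t | t ∈ X.polytope L ∧
    ∀ t' ∈ X.polytope L, ∑ i, (1 / (m i : ℝ)) * t' i ≤ ∑ i, (1 / (m i : ℝ)) * t i}

/-- The inclusion of the dual space of `Pic(X)_ℝ` in `ℝˢ`, the space of linear functions on
`⊕ ℝ D i`; it sends `l` to the tuple `l [D i]`. -/
def dualIncl : Module.Dual ℝ X.PicR →ₗ[ℝ] (Fin s → ℝ) where
  toFun l := fun i => l (X.toPic (Pi.single i 1))
  map_add' _ _ := rfl
  map_smul' _ _ := rfl

/-- The subspace `H̃` of `ℝˢ` that is identified with the dual space of `Pic(X)_ℝ`. -/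
def dualPic : Submodule ℝ (Fin s → ℝ) := LinearMap.range X.dualIncl

/-- The cone generated by `F̃`, viewed in the dual space of `Pic(X)_ℝ`. -/
def coneOfMaximalFace (m : Fin s → ℕ) (L : Fin s → ℚ) :
    PointedCone ℝ (Module.Dual ℝ X.PicR) :=
  (PointedCone.hull ℝ (X.maximalFace m L)).comap X.dualIncl

end SmoothCompleteFan

/-!
The theorem is linear programming duality, combined with the duality between faces of a finitely
generated cone and faces of its dual cone.

An element `t` of `Eff(X)ᵛ` is a nonnegative tuple with `∑ t i • ray i = 0`, and on such tuples every
divisor `L(σ)`, being equivalent to `L`, takes the same value `∑ L i * t i`. Hence `P̃ ∩ H̃` is the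
part of `Eff(X)ᵛ` where `L` is at most `1`, and by Farkas' lemma the maximum of `∑ t i / m i` on it
is the minimal `c` with `c [L] + [K_X + Δ]` effective (`isLeast_adjointSet`). Enlarging `P̃ ∩ H̃` to
`P̃` does not change the maximal face: a point `t` of `P̃` outside `H̃` is moved into `P̃ ∩ H̃` by
adding nonnegative multiples of the rays of a cone `σ` that contains `-∑ t i • ray i`. This does not
affect the value of `L(σ)`, whose coefficients on `σ` vanish, but increases `∑ t i / m i`
(`maximalFace_subset_dualPic`).

It follows that `cone(F̃)` consists of the elements of `Eff(X)ᵛ` that vanish at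
`y = a(L) [L] + [K_X + Δ]` (`mem_coneOfMaximalFace_iff`). For any finitely generated cone `C` and
`y ∈ C`, Farkas' lemma for the cone `C - ℝ≥0 y` shows that this subset of the dual cone is dual to
the minimal face of `C` at `y` (`areDualFaces_minimalFace`), and that the linear span of the minimal
face is its full annihilator (`span_minimalFace`). So `b(L)` is the dimension of the span of `F̃`,
which is `dim F̃ + 1` since `∑ L i * t i = 1` on `F̃`.
-/

open Module

/-! ### Farkas' lemma and minimal faces of finitely generated cones -/

section Cone

variable {V : Type*} [AddCommGroup V] [Module ℝ V]

/-- **Farkas' lemma**, by induction on the number of generators. -/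
theorem exists_nonneg_sum_smul_of_forall_dual {ι : Type*} (S : Finset ι) (v : ι → V) (w : V)
    (h : ∀ l : Dual ℝ V, (∀ i ∈ S, 0 ≤ l (v i)) → 0 ≤ l w) :
    ∃ c : ι → ℝ, (∀ i, 0 ≤ c i) ∧ w = ∑ i ∈ S, c i • v i := by
  classical
  induction S using Finset.induction_on generalizing v w with
  | empty =>
    refine ⟨0, fun _ => le_rfl, ?_⟩
    rw [Finset.sum_empty, ← forall_dual_apply_eq_zero_iff ℝ w]
    intro l
    have h1 := h l (by simp)
    have h2 := h (-l) (by simp)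
    rw [LinearMap.neg_apply] at h2
    linarith
  | insert k S hk ih =>
    by_cases hw : ∀ l : Dual ℝ V, (∀ i ∈ S, 0 ≤ l (v i)) → 0 ≤ l w
    · obtain ⟨c, hc, rfl⟩ := ih v w hw
      refine ⟨fun i => if i = k then 0 else c i, fun i => ?_, ?_⟩
      · dsimp only
        split_ifs
        exacts [le_rfl, hc i]
      · rw [Finset.sum_insert hk]
        simp only [if_true, zero_smul, zero_add]
        refine Finset.sum_congr rfl fun i hi => ?_
        rw [if_neg (ne_of_mem_of_not_mem hi hk)]
    · push Not at hw
      obtain ⟨l₀, hl₀, hl₀w⟩ := hw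
      have hk₀ : l₀ (v k) < 0 := by
        by_contra! hcon
        exact absurd (h l₀ (by simpa [hcon] using hl₀)) (not_le.2 hl₀w)
      -- Project everything to the kernel of `l₀` along `v k`: the induction hypothesis applies
      -- there, because a functional can be corrected by a multiple of `l₀` to vanish at `v k`.
      obtain ⟨c, hc, hcw⟩ := ih (fun i => v i - (l₀ (v i) / l₀ (v k)) • v k)
        (w - (l₀ w / l₀ (v k)) • v k) (by
          intro l hl
          have key := h (l - (l (v k) / l₀ (v k)) • l₀) (by
            intro i hi
            rcases Finset.mem_insert.1 hi with rfl | hi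
            · simp [hk₀.ne]
            · have := hl i hi
              simp only [map_sub, map_smul, smul_eq_mul, LinearMap.sub_apply,
                LinearMap.smul_apply] at this ⊢
              calc 0 ≤ _ := this
                _ = _ := by ring)
          simp only [map_sub, map_smul, smul_eq_mul, LinearMap.sub_apply,
            LinearMap.smul_apply] at key ⊢
          calc 0 ≤ _ := key
            _ = _ := by ring)
      refine ⟨fun i => if i = k then l₀ w / l₀ (v k) - ∑ j ∈ S, c j * (l₀ (v j) / l₀ (v k))
        else c i, fun i => ?_, ?_⟩
      · dsimp only
        split_ifs
        · have h1 : 0 ≤ l₀ w / l₀ (v k) := div_nonneg_of_nonpos hl₀w.le hk₀.le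
          have h2 : ∑ j ∈ S, c j * (l₀ (v j) / l₀ (v k)) ≤ 0 :=
            Finset.sum_nonpos fun j hj => mul_nonpos_of_nonneg_of_nonpos (hc j)
              (div_nonpos_of_nonneg_of_nonpos (hl₀ j hj) hk₀.le)
          linarith
        · exact hc i
      · rw [Finset.sum_insert hk]
        have h3 : ∑ i ∈ S, (if i = k then l₀ w / l₀ (v k) -
            ∑ j ∈ S, c j * (l₀ (v j) / l₀ (v k)) else c i) • v i = ∑ i ∈ S, c i • v i :=
          Finset.sum_congr rfl fun i hi => by rw [if_neg (ne_of_mem_of_not_mem hi hk)]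
        beta_reduce
        rw [h3, if_pos rfl, sub_smul, Finset.sum_smul]
        rw [sub_eq_iff_eq_add] at hcw
        refine hcw.trans ?_
        simp only [smul_sub, Finset.sum_sub_distrib, smul_smul]
        abel

theorem PointedCone.exists_nonneg_of_mem_hull {ι : Type*} [Fintype ι] {f : ι → V} {σ : Set ι} {v : V} (hv : v ∈ PointedCone.hull ℝ (f '' σ)) :
    ∃ c : ι → ℝ, (∀ i, 0 ≤ c i) ∧ (∀ i ∉ σ, c i = 0) ∧ v = ∑ i, c i • f i := by
  classical
  induction hv using Submodule.span_induction with
  | mem v hv =>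
    obtain ⟨i, hi, rfl⟩ := hv
    refine ⟨Pi.single i 1, fun j => ?_, fun j hj => ?_, ?_⟩
    · exact (Pi.single_nonneg.2 zero_le_one : (0 : ι → ℝ) ≤ Pi.single i 1) j
    · exact Pi.single_eq_of_ne (ne_of_mem_of_not_mem hi hj).symm _
    · simp [Pi.single_apply]
  | zero => exact ⟨0, fun _ => le_rfl, fun _ _ => rfl, by simp⟩
  | add v w _ _ hv hw =>
    obtain ⟨c, hc, hc', rfl⟩ := hv
    obtain ⟨d, hd, hd', rfl⟩ := hw
    exact ⟨c + d, fun i => add_nonneg (hc i) (hd i), fun i hi => by simp [hc' i hi, hd' i hi],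
      by simp [add_smul, Finset.sum_add_distrib]⟩
  | smul a v _ hv =>
    obtain ⟨c, hc, hc', rfl⟩ := hv
    exact ⟨(a : ℝ) • c, fun i => mul_nonneg a.2 (hc i), fun i hi => by simp [hc' i hi],
      by simp only [Finset.smul_sum, Pi.smul_apply, smul_assoc]; rfl⟩

variable {C : PointedCone ℝ V} {y : V}

/-- A finitely generated cone is its own double dual. -/
theorem PointedCone.mem_of_forall_dual (hC : C.FG) {w : V}
    (h : ∀ l : Dual ℝ V, (∀ x ∈ C, 0 ≤ l x) → 0 ≤ l w) : w ∈ C := by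
  obtain ⟨S, rfl⟩ := hC
  obtain ⟨c, hc, rfl⟩ := exists_nonneg_sum_smul_of_forall_dual S id w (by
    intro l hl
    refine h l fun x hx => ?_
    induction hx using Submodule.span_induction with
    | mem x hx => exact hl x hx
    | zero => simp
    | add x z _ _ hx hz => rw [map_add]; exact add_nonneg hx hz
    | smul a x _ hx =>
      have : l (a • x) = (a : ℝ) * l x := by rw [← smul_eq_mul, ← map_smul]; rfl
      rw [this]
      exact mul_nonneg a.2 hx)
  exact Submodule.sum_mem _ fun i hi => PointedCone.smul_mem _ (hc i) (Submodule.subset_span hi)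

/-- Farkas' lemma for the cone `C - ℝ≥0 y`, whose dual is the face of `Cᵛ` cut out by `y`. -/
theorem PointedCone.exists_eq_sub_smul (hC : C.FG) (hy : y ∈ C) {v : V}
    (h : ∀ l : Dual ℝ V, (∀ x ∈ C, 0 ≤ l x) → l y = 0 → 0 ≤ l v) :
    ∃ e ∈ C, ∃ c : ℝ, 0 ≤ c ∧ v = e - c • y := by
  have hmem : v ∈ C ⊔ PointedCone.hull ℝ {-y} := by
    refine PointedCone.mem_of_forall_dual (hC.sup (Submodule.fg_span_singleton _)) fun l hl => ?_
    have h1 : ∀ x ∈ C, 0 ≤ l x := fun x hx => hl x (Submodule.mem_sup_left hx)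
    have h2 : 0 ≤ l (-y) :=
      hl _ (Submodule.mem_sup_right (Submodule.subset_span (Set.mem_singleton _)))
    refine h l h1 (le_antisymm ?_ (h1 y hy))
    rw [map_neg] at h2
    linarith
  obtain ⟨e, he, z, hz, rfl⟩ := Submodule.mem_sup.1 hmem
  obtain ⟨c, rfl⟩ := Submodule.mem_span_singleton.1 hz
  refine ⟨e, he, c, c.2, ?_⟩
  rw [smul_neg, ← sub_eq_add_neg]
  rfl

theorem isLeast_minimalFace (hy : y ∈ C) :
    IsLeast {G : PointedCone ℝ V | G.IsFaceOf C ∧ y ∈ G} (minimalFace C y) := by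
  refine ⟨⟨?_, ?_⟩, fun G hG => sInf_le hG⟩
  · have h := PointedCone.IsFaceOf.sInf (C := C) {G | G.IsFaceOf C ∧ y ∈ G} fun G hG => hG.1
    have hC : C ∈ {G : PointedCone ℝ V | G.IsFaceOf C ∧ y ∈ G} := ⟨.refl C, hy⟩
    rwa [inf_eq_right.2 (sInf_le hC)] at h
  · exact Submodule.mem_sInf.2 fun G hG => hG.2

/-- The zeros in `C` of a set of functionals that are nonnegative on `C` form a face. -/
theorem PointedCone.exists_isFaceOf_of_dual (C : PointedCone ℝ V) (A : Set (Dual ℝ V))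
    (hA : ∀ l ∈ A, ∀ x ∈ C, 0 ≤ l x) :
    ∃ F : PointedCone ℝ V, F.IsFaceOf C ∧ ∀ x, x ∈ F ↔ x ∈ C ∧ ∀ l ∈ A, l x = 0 := by
  refine ⟨C ⊓ PointedCone.ofSubmodule (Submodule.span ℝ A).dualCoannihilator, ⟨inf_le_left, ?_⟩,
    fun x => ?_⟩
  · rintro x z a hx hz ha ⟨-, h⟩
    refine ⟨hx, ?_⟩
    rw [SetLike.mem_coe, PointedCone.mem_ofSubmodule_iff, ← SetLike.mem_coe,
      Submodule.coe_dualCoannihilator_span] at h ⊢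
    intro l hl
    have h1 := h l hl
    rw [map_add, map_smul, smul_eq_mul] at h1
    have h2 := hA l hl x hx
    have h3 := hA l hl z hz
    have h4 : 0 ≤ a * l x := mul_nonneg ha.le h2
    have h5 : a * l x = 0 := by linarith
    exact (mul_eq_zero.1 h5).resolve_left ha.ne'
  · rw [Submodule.mem_inf, PointedCone.mem_ofSubmodule_iff, ← SetLike.mem_coe (p :=
      (Submodule.span ℝ A).dualCoannihilator), Submodule.coe_dualCoannihilator_span]
    rfl

/-- The minimal face of `C` at `y` is cut out by the functionals of `Cᵛ` that vanish at `y`. -/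
theorem mem_minimalFace_iff (hC : C.FG) (hy : y ∈ C) {x : V} :
    x ∈ minimalFace C y ↔
      x ∈ C ∧ ∀ l : Dual ℝ V, (∀ z ∈ C, 0 ≤ l z) → l y = 0 → l x = 0 := by
  constructor
  · intro hx
    obtain ⟨F, hF, hmem⟩ := C.exists_isFaceOf_of_dual {l | (∀ z ∈ C, 0 ≤ l z) ∧ l y = 0}
      fun (l : Dual ℝ V) hl => hl.1
    have h := (hmem x).1 ((isLeast_minimalFace hy).2 ⟨hF, (hmem y).2 ⟨hy, fun l hl => hl.2⟩⟩ hx)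
    exact ⟨h.1, fun l h1 h2 => h.2 l ⟨h1, h2⟩⟩
  · rintro ⟨hx, h⟩
    refine Submodule.mem_sInf.2 fun G ⟨hG, hyG⟩ => ?_
    obtain ⟨e, he, c, hc, hxe⟩ := PointedCone.exists_eq_sub_smul hC hy (v := -x)
      fun l h1 h2 => by rw [map_neg, h l h1 h2, neg_zero]
    refine hG.mem_of_add_mem_left hx he ?_
    have : x + e = c • y := by
      rw [eq_sub_iff_add_eq] at hxe
      rw [← hxe]
      abel
    rw [this]
    exact PointedCone.smul_mem G hc hyG

/-- If `G'` is the face of `Cᵛ` cut out by `y`, then it is dual to the minimal face at `y`. -/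
theorem areDualFaces_minimalFace (hC : C.FG) (hy : y ∈ C) {G' : PointedCone ℝ (Dual ℝ V)}
    (hG' : ∀ l, l ∈ G' ↔ (∀ x ∈ C, 0 ≤ l x) ∧ l y = 0) :
    AreDualFaces C (minimalFace C y) G' := by
  have hle := isLeast_minimalFace hy
  refine ⟨hle.1.1, ?_, fun l => ⟨fun hl => ?_, fun hl => ?_⟩, fun x => ?_⟩
  · refine ⟨fun l hl x hx => ((hG' l).1 hl).1 x hx, fun {l l' a} hl hl' ha h => (hG' l).2 ⟨hl, ?_⟩⟩
    have h1 := ((hG' _).1 h).2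
    rw [LinearMap.add_apply, LinearMap.smul_apply, smul_eq_mul] at h1
    have h2 : 0 ≤ l y := hl hy
    have h3 : 0 ≤ l' y := hl' hy
    have h4 : 0 ≤ a * l y := mul_nonneg ha.le h2
    exact (mul_eq_zero.1 (by linarith : a * l y = 0)).resolve_left ha.ne'
  · have h := (hG' l).1 hl
    exact ⟨h.1, fun x hx => ((mem_minimalFace_iff hC hy).1 hx).2 l h.1 h.2⟩
  · exact (hG' l).2 ⟨hl.1, hl.2 y hle.1.2⟩
  · rw [mem_minimalFace_iff hC hy]
    refine and_congr_right fun _ => forall_congr' fun l => ?_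
    rw [hG', and_imp]

theorem span_minimalFace (hC : C.FG) (hy : y ∈ C) {G' : PointedCone ℝ (Dual ℝ V)}
    (hG' : ∀ l, l ∈ G' ↔ (∀ x ∈ C, 0 ≤ l x) ∧ l y = 0) :
    Submodule.span ℝ (minimalFace C y : Set V) =
      (Submodule.span ℝ (G' : Set (Dual ℝ V))).dualCoannihilator := by
  have hperp : ∀ x, x ∈ (Submodule.span ℝ (G' : Set (Dual ℝ V))).dualCoannihilator ↔
      ∀ l ∈ G', l x = 0 := by
    intro x
    rw [← SetLike.mem_coe, Submodule.coe_dualCoannihilator_span]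
    rfl
  have hyG : y ∈ minimalFace C y := (isLeast_minimalFace hy).1.2
  refine le_antisymm (Submodule.span_le.2 fun x hx => (hperp x).2 fun l hl => ?_) fun x hx => ?_
  · have h := (hG' l).1 hl
    exact ((mem_minimalFace_iff hC hy).1 hx).2 l h.1 h.2
  · have hx0 : ∀ l : Dual ℝ V, (∀ z ∈ C, 0 ≤ l z) → l y = 0 → l x = 0 :=
      fun l h1 h2 => (hperp x).1 hx l ((hG' l).2 ⟨h1, h2⟩)
    obtain ⟨e, he, c, -, rfl⟩ := PointedCone.exists_eq_sub_smul hC hy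
      fun l h1 h2 => (hx0 l h1 h2).ge
    have heG : e ∈ minimalFace C y := by
      refine (mem_minimalFace_iff hC hy).2 ⟨he, fun l h1 h2 => ?_⟩
      simpa [h2] using hx0 l h1 h2
    exact Submodule.sub_mem _ (Submodule.subset_span heG)
      (Submodule.smul_mem _ c (Submodule.subset_span hyG))

theorem finrank_quotient_span_minimalFace [FiniteDimensional ℝ V] (hC : C.FG) (hy : y ∈ C)
    {G' : PointedCone ℝ (Dual ℝ V)} (hG' : ∀ l, l ∈ G' ↔ (∀ x ∈ C, 0 ≤ l x) ∧ l y = 0) :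
    finrank ℝ (V ⧸ Submodule.span ℝ (minimalFace C y : Set V)) =
      finrank ℝ (Submodule.span ℝ (G' : Set (Dual ℝ V))) := by
  have h1 := Submodule.finrank_quotient_add_finrank
    (Submodule.span ℝ (minimalFace C y : Set V))
  have h2 := Subspace.finrank_add_finrank_dualCoannihilator_eq
    (Submodule.span ℝ (G' : Set (Dual ℝ V)))
  rw [span_minimalFace hC hy hG'] at h1 ⊢
  omega

theorem finrank_span_eq_affineDim_add_one [FiniteDimensional ℝ V] {S : Set V} (hS : S.Nonempty)
    (f : Dual ℝ V) (hf : ∀ x ∈ S, f x = 1) :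
    finrank ℝ (Submodule.span ℝ S) = affineDim S + 1 := by
  obtain ⟨p, hp⟩ := hS
  have hker : ∀ v ∈ vectorSpan ℝ S, f v = 0 := by
    intro v hv
    have hle : vectorSpan ℝ S ≤ LinearMap.ker f := by
      rw [vectorSpan_def, Submodule.span_le]
      rintro _ ⟨x, hx, z, hz, rfl⟩
      simp [hf x hx, hf z hz]
    exact hle hv
  have hp0 : p ≠ 0 := by
    rintro rfl
    simpa using hf 0 hp
  have hsup : Submodule.span ℝ S = vectorSpan ℝ S ⊔ Submodule.span ℝ {p} := by
    refine le_antisymm (Submodule.span_le.2 fun x hx => ?_) (sup_le ?_ ?_)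
    · rw [← sub_add_cancel x p]
      exact Submodule.add_mem_sup (vsub_mem_vectorSpan ℝ hx hp)
        (Submodule.mem_span_singleton_self p)
    · rw [vectorSpan_def, Submodule.span_le]
      rintro _ ⟨x, hx, z, hz, rfl⟩
      exact Submodule.sub_mem _ (Submodule.subset_span hx) (Submodule.subset_span hz)
    · exact Submodule.span_mono (Set.singleton_subset_iff.2 hp)
  have hinf : vectorSpan ℝ S ⊓ Submodule.span ℝ {p} = ⊥ := by
    rw [eq_bot_iff]
    rintro v ⟨hv, hv'⟩
    obtain ⟨c, rfl⟩ := Submodule.mem_span_singleton.1 hv'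
    have := hker _ hv
    rw [map_smul, hf p hp, smul_eq_mul, mul_one] at this
    simp [this]
  have h := Submodule.finrank_sup_add_finrank_inf_eq (vectorSpan ℝ S) (Submodule.span ℝ {p})
  rw [← hsup, hinf, finrank_bot, finrank_span_singleton hp0, add_zero] at h
  rw [h, affineDim, direction_affineSpan]

end Cone

/-! ### Classes of divisors and the dual of `Pic(X)_ℝ` -/

namespace SmoothCompleteFan

variable {n s : ℕ} (X : SmoothCompleteFan n s)

theorem dual_toPic (l : Dual ℝ X.PicR) (d : Fin s → ℝ) :
    l (X.toPic d) = ∑ i, d i * X.dualIncl l i := by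
  have h := LinearMap.pi_apply_eq_sum_univ (l ∘ₗ X.toPic) d
  rw [LinearMap.comp_apply] at h
  rw [h]
  refine Finset.sum_congr rfl fun i _ => ?_
  rw [smul_eq_mul]
  congr 1
  change l (X.toPic _) = l (X.toPic _)
  congr 2
  ext j
  simp [Pi.single_apply, eq_comm]

theorem dualIncl_injective : Function.Injective X.dualIncl := by
  refine (injective_iff_map_eq_zero _).2 fun l hl => ?_
  ext d
  change l (X.toPic _) = 0
  rw [dual_toPic, hl]
  simp

theorem dual_eval_character (u : Dual ℝ (Fin n → ℝ)) (t : Fin s → ℝ) :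
    ∑ i, u (X.rayR i) * t i = u (∑ i, t i • X.rayR i) := by
  simp [map_sum, mul_comm]

/-- `H̃` consists of the relations between the ray generators. -/
theorem mem_dualPic_iff {t : Fin s → ℝ} : t ∈ X.dualPic ↔ ∑ i, t i • X.rayR i = 0 := by
  constructor
  · rintro ⟨l, rfl⟩
    rw [← forall_dual_apply_eq_zero_iff ℝ]
    intro u
    rw [← dual_eval_character]
    have h : X.toPic (X.divR u) = 0 := by simp
    have h' := X.dual_toPic l (X.divR u)
    rw [h, map_zero] at h'
    exact h'.symm
  · intro h
    have hle : LinearMap.range X.divR ≤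
        LinearMap.ker (∑ i, t i • (LinearMap.proj i : (Fin s → ℝ) →ₗ[ℝ] ℝ)) := by
      rintro _ ⟨u, rfl⟩
      have := X.dual_eval_character u t
      rw [h, map_zero] at this
      rw [LinearMap.mem_ker, ← this]
      simp [divR, mul_comm]
    refine ⟨(LinearMap.range X.divR).liftQ _ hle, ?_⟩
    ext i
    change (LinearMap.range X.divR).liftQ _ hle (Submodule.Quotient.mk _) = _
    rw [Submodule.liftQ_apply]
    simp [Pi.single_apply]

theorem Eff_fg : X.Eff.FG := by
  refine Submodule.FG.map _ ⟨Finset.univ.image fun i => Pi.single i 1, ?_⟩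
  refine le_antisymm (Submodule.span_le.2 ?_) fun d hd => ?_
  · intro v hv
    obtain ⟨i, rfl⟩ : ∃ i, Pi.single i 1 = v := by simpa using hv
    exact Pi.single_nonneg.2 zero_le_one
  · have h : d = ∑ i, d i • Pi.single i (1 : ℝ) := by
      ext j
      simp [Pi.single_apply]
    rw [h]
    refine Submodule.sum_mem _ fun i _ => PointedCone.smul_mem _ (hd i) (Submodule.subset_span ?_)
    simp

theorem dual_nonneg_iff {l : Dual ℝ X.PicR} :
    (∀ x ∈ X.Eff, 0 ≤ l x) ↔ ∀ i, 0 ≤ X.dualIncl l i := by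
  constructor
  · intro h i
    exact h _ (PointedCone.mem_map.2 ⟨_, Pi.single_nonneg.2 zero_le_one, rfl⟩)
  · rintro h x hx
    obtain ⟨d, hd, rfl⟩ := PointedCone.mem_map.1 hx
    rw [dual_toPic]
    exact Finset.sum_nonneg fun i _ => mul_nonneg (hd i) (h i)

theorem dual_adjoint (m : Fin s → ℕ) (L : Fin s → ℚ) (c : ℝ) (l : Dual ℝ X.PicR) :
    l (c • X.cls L + X.cls (logCanonical m)) =
      c * ∑ i, (L i : ℝ) * X.dualIncl l i - ∑ i, (1 / (m i : ℝ)) * X.dualIncl l i := by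
  rw [map_add, map_smul, cls, cls, dual_toPic, dual_toPic, smul_eq_mul, sub_eq_add_neg,
    ← Finset.sum_neg_distrib]
  congr 1
  refine Finset.sum_congr rfl fun i _ => ?_
  rw [neg_mul_eq_neg_mul]
  congr 1
  push_cast [logCanonical]
  ring

/-! ### The divisors `L(σ)` -/

variable {X} {m : Fin s → ℕ} {L : Fin s → ℚ}

theorem coeff_eq_zero (σ : X.maxCones) {i : Fin s} (hi : i ∈ σ.1) : X.coeff L σ i = 0 := by
  have h := (X.existsUnique_character σ (fun j => (L j : ℝ))).choose_spec.1 i hi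
  exact sub_eq_zero.2 h.symm

theorem coeff_nonneg (hL : X.IsSemiample L) (σ : X.maxCones) (i : Fin s) :
    0 ≤ X.coeff L σ i := by
  obtain ⟨t, ht, E, hE, hbpf⟩ := hL
  obtain ⟨f, hf, hfσ⟩ := hbpf σ.1 σ.2
  have ht' : (0 : ℝ) < t := Nat.cast_pos.2 ht
  have hE' : ∀ j, (E j : ℝ) = t * L j := fun j => by
    exact_mod_cast congrArg (Rat.cast (K := ℝ)) (hE j)
  -- By uniqueness of `u_{σ,L}`, it is `-f / t` for the section `f` that trivializes `E` on `U_σ`.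
  let g : Dual ℝ (Fin n → ℝ) := ∑ k, (-(f (Pi.single k 1) : ℝ) / t) • LinearMap.proj k
  have hg : ∀ j, g (X.rayR j) = -(f (X.ray j) : ℝ) / t := by
    intro j
    rw [LinearMap.pi_apply_eq_sum_univ f (X.ray j)]
    simp only [g, LinearMap.sum_apply, LinearMap.smul_apply, LinearMap.proj_apply, smul_eq_mul,
      rayR, Int.cast_sum, Int.cast_mul]
    rw [neg_div, Finset.sum_div, ← Finset.sum_neg_distrib]
    refine Finset.sum_congr rfl fun k _ => ?_
    have : (Pi.single k 1 : Fin n → ℤ) = fun j => if k = j then 1 else 0 := by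
      ext j
      simp [Pi.single_apply, eq_comm]
    rw [this]
    ring
  have hu : X.u σ L = g := by
    have hex := X.existsUnique_character σ (fun j => (L j : ℝ))
    refine hex.unique hex.choose_spec.1 fun j hj => ?_
    rw [hg, div_eq_iff ht'.ne', mul_comm, ← hE', neg_eq_iff_add_eq_zero]
    exact_mod_cast hfσ j hj
  rw [coeff, hu, hg, neg_div, sub_neg_eq_add]
  have h := hf i
  have h' : (0 : ℝ) ≤ f (X.ray i) + E i := by exact_mod_cast h
  rw [hE'] at h'
  have : (L i : ℝ) + f (X.ray i) / t = (f (X.ray i) + t * L i) / t := by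
    field_simp
    ring
  rw [this]
  exact div_nonneg h' ht'.le

/-- On `H̃` all the divisors `L(σ)`, being equivalent to `L`, have the same value. -/
theorem sum_coeff_mul {t : Fin s → ℝ} (ht : ∑ i, t i • X.rayR i = 0) (σ : X.maxCones) :
    ∑ i, X.coeff L σ i * t i = ∑ i, (L i : ℝ) * t i := by
  have h := X.dual_eval_character (X.u σ L) t
  rw [ht, map_zero] at h
  simp only [coeff, sub_mul, Finset.sum_sub_distrib, h, sub_zero]

theorem sum_mul_nonneg (hs : X.IsSemiample L) {t : Fin s → ℝ} (ht : ∑ i, t i • X.rayR i = 0)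
    (ht0 : ∀ i, 0 ≤ t i) : 0 ≤ ∑ i, (L i : ℝ) * t i := by
  obtain ⟨σ, hσ, -⟩ := X.complete 0
  rw [← sum_coeff_mul ht ⟨σ, hσ⟩]
  exact Finset.sum_nonneg fun i _ => mul_nonneg (coeff_nonneg hs _ i) (ht0 i)

theorem eq_zero_of_sum_mul_eq_zero (hs : X.IsSemiample L)
    (hL : ∀ i, ∃ σ : X.maxCones, 0 < X.coeff L σ i) {t : Fin s → ℝ}
    (ht : ∑ i, t i • X.rayR i = 0) (ht0 : ∀ i, 0 ≤ t i) (h : ∑ i, (L i : ℝ) * t i = 0) :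
    t = 0 := by
  ext i
  obtain ⟨σ, hσ⟩ := hL i
  rw [← sum_coeff_mul ht σ, Finset.sum_eq_zero_iff_of_nonneg
    fun i _ => mul_nonneg (coeff_nonneg hs _ i) (ht0 i)] at h
  exact (mul_eq_zero.1 (h i (Finset.mem_univ i))).resolve_left hσ.ne'

/-! ### The polytope and its maximal face -/

theorem isCompact_polytope (hs : X.IsSemiample L)
    (hL : ∀ i, ∃ σ : X.maxCones, 0 < X.coeff L σ i) : IsCompact (X.polytope L) := by
  choose σ hσ using hL
  refine (isCompact_Icc (a := (0 : Fin s → ℝ))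
    (b := fun i => 1 / X.coeff L (σ i) i)).of_isClosed_subset ?_ fun t ht => ⟨ht.1, fun i => ?_⟩
  · have : X.polytope L = (⋂ i, {t | 0 ≤ t i}) ∩
        ⋂ σ : X.maxCones, {t | ∑ i, X.coeff L σ i * t i ≤ 1} := by
      ext t
      simp [polytope]
    rw [this]
    exact (isClosed_iInter fun i => isClosed_le (by fun_prop) (by fun_prop)).inter
      (isClosed_iInter fun σ => isClosed_le (by fun_prop) (by fun_prop))
  · rw [le_div_iff₀ (hσ i), mul_comm]
    exact (Finset.single_le_sum (f := fun j => X.coeff L (σ i) j * t j)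
      (fun j _ => mul_nonneg (coeff_nonneg hs _ j) (ht.1 j)) (Finset.mem_univ i)).trans (ht.2 _)

theorem maximalFace_nonempty (m : Fin s → ℕ) (hs : X.IsSemiample L)
    (hL : ∀ i, ∃ σ : X.maxCones, 0 < X.coeff L σ i) : (X.maximalFace m L).Nonempty := by
  obtain ⟨t, ht, hmax⟩ := (isCompact_polytope hs hL).exists_isMaxOn
    ⟨0, fun _ => le_rfl, fun σ => by simp⟩
    (f := fun t : Fin s → ℝ => ∑ i, (1 / (m i : ℝ)) * t i) (by fun_prop)
  exact ⟨t, ht, fun t' ht' => hmax ht'⟩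

theorem maximum_pos (hn : 0 < n) (hm : ∀ i, 0 < m i) (hs : X.IsSemiample L) {t : Fin s → ℝ}
    (ht : t ∈ X.maximalFace m L) : 0 < ∑ i, (1 / (m i : ℝ)) * t i := by
  obtain ⟨i⟩ : Nonempty (Fin s) := by
    by_contra hempty
    rw [not_nonempty_iff] at hempty
    obtain ⟨σ, -, hσ⟩ := X.complete fun _ => 1
    obtain ⟨c, -, -, hc⟩ := PointedCone.exists_nonneg_of_mem_hull hσ
    rw [Finset.univ_eq_empty, Finset.sum_empty] at hc
    exact one_ne_zero (congrFun hc ⟨0, hn⟩)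
  have hsum : 0 ≤ ∑ σ, X.coeff L σ i := Finset.sum_nonneg fun σ _ => coeff_nonneg hs σ i
  have hpos : 0 < 1 + ∑ σ, X.coeff L σ i := by linarith
  have hmi : (0 : ℝ) < m i := Nat.cast_pos.2 (hm i)
  refine lt_of_lt_of_le ?_ (ht.2 (Pi.single i (1 + ∑ σ, X.coeff L σ i)⁻¹) ⟨?_, fun σ => ?_⟩)
  · simp only [Pi.single_apply, mul_ite, mul_zero, Finset.sum_ite_eq', Finset.mem_univ, if_true]
    positivity
  · exact (Pi.single_nonneg.2 (inv_nonneg.2 hpos.le) : (0 : Fin s → ℝ) ≤ _)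
  · simp only [Pi.single_apply, mul_ite, mul_zero, Finset.sum_ite_eq', Finset.mem_univ, if_true]
    rw [← div_eq_mul_inv, div_le_one hpos]
    have := Finset.single_le_sum (f := fun σ => X.coeff L σ i) (fun σ _ => coeff_nonneg hs σ i)
      (Finset.mem_univ σ)
    linarith

/-- A point of `P̃` outside `H̃` is not maximal: since the fan is complete, it can be moved into
`H̃` by increasing its coordinates on some cone `σ`, which does not change the value of `L(σ)`. -/
theorem maximalFace_subset_dualPic (hm : ∀ i, 0 < m i) : X.maximalFace m L ⊆ X.dualPic := by
  intro t ht
  rw [SetLike.mem_coe, mem_dualPic_iff]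
  obtain ⟨σ, hσ, hmem⟩ := X.complete (-∑ i, t i • X.rayR i)
  obtain ⟨c, hc, hcσ, hsum⟩ := PointedCone.exists_nonneg_of_mem_hull hmem
  have hsum' : -∑ i, t i • X.rayR i = ∑ i, c i • X.rayR i := hsum
  have hrel : ∑ i, (t + c) i • X.rayR i = 0 := by
    simp only [Pi.add_apply, add_smul, Finset.sum_add_distrib]
    rw [← hsum', add_neg_cancel]
  have hmax := ht.2 (t + c) ⟨fun i => add_nonneg (ht.1.1 i) (hc i), fun τ => by
    rw [sum_coeff_mul hrel, ← sum_coeff_mul hrel ⟨σ, hσ⟩]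
    refine le_trans (Finset.sum_le_sum fun i _ => ?_) (ht.1.2 ⟨σ, hσ⟩)
    by_cases hi : i ∈ σ
    · simp [coeff_eq_zero (L := L) ⟨σ, hσ⟩ hi]
    · simp [hcσ i hi]⟩
  have hc0 : ∀ i, c i = 0 := by
    simp only [Pi.add_apply, mul_add, Finset.sum_add_distrib] at hmax
    have hnn : ∀ i ∈ Finset.univ, 0 ≤ (1 / (m i : ℝ)) * c i := fun i _ =>
      mul_nonneg (by positivity) (hc i)
    have h0 : ∑ i, (1 / (m i : ℝ)) * c i = 0 :=
      le_antisymm (by linarith) (Finset.sum_nonneg hnn)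
    intro i
    have hi := (Finset.sum_eq_zero_iff_of_nonneg hnn).1 h0 i (Finset.mem_univ i)
    exact (mul_eq_zero.1 hi).resolve_left (one_div_ne_zero (Nat.cast_ne_zero.2 (hm i).ne'))
  rw [← neg_eq_zero, hsum']
  simp [hc0]

theorem inv_smul_mem_polytope {t : Fin s → ℝ} (ht : ∑ i, t i • X.rayR i = 0) (ht0 : ∀ i, 0 ≤ t i)
    (hpos : 0 < ∑ i, (L i : ℝ) * t i) : (∑ i, (L i : ℝ) * t i)⁻¹ • t ∈ X.polytope L := by
  refine ⟨fun i => mul_nonneg (inv_nonneg.2 hpos.le) (ht0 i), fun σ => le_of_eq ?_⟩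
  rw [← inv_mul_cancel₀ hpos.ne']
  simp only [Pi.smul_apply, smul_eq_mul, mul_left_comm _ (∑ i, (L i : ℝ) * t i)⁻¹,
    ← Finset.mul_sum, sum_coeff_mul ht]

/-- The maximum of `∑ t i / m i` over `P̃` bounds the same function on the cone `Eff(X)ᵛ`. -/
theorem sum_div_le (hs : X.IsSemiample L) (hL : ∀ i, ∃ σ : X.maxCones, 0 < X.coeff L σ i)
    {t₀ : Fin s → ℝ} (ht₀ : t₀ ∈ X.maximalFace m L) {t : Fin s → ℝ}
    (ht : ∑ i, t i • X.rayR i = 0) (ht0 : ∀ i, 0 ≤ t i) :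
    ∑ i, (1 / (m i : ℝ)) * t i ≤ (∑ i, (1 / (m i : ℝ)) * t₀ i) * ∑ i, (L i : ℝ) * t i := by
  rcases (sum_mul_nonneg hs ht ht0).eq_or_lt with h | h
  · simp [eq_zero_of_sum_mul_eq_zero hs hL ht ht0 h.symm]
  · have h1 := ht₀.2 _ (inv_smul_mem_polytope ht ht0 h)
    simp only [Pi.smul_apply, smul_eq_mul, mul_left_comm _ (∑ i, (L i : ℝ) * t i)⁻¹,
      ← Finset.mul_sum] at h1
    rwa [inv_mul_le_iff₀ h, mul_comm] at h1

/-- The constraint by `L` is tight on `F̃`, as otherwise scaling up would increase the positive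
maximum. -/
theorem sum_mul_eq_one (hn : 0 < n) (hm : ∀ i, 0 < m i) (hs : X.IsSemiample L)
    (hL : ∀ i, ∃ σ : X.maxCones, 0 < X.coeff L σ i)
    {t : Fin s → ℝ} (ht : t ∈ X.maximalFace m L) : ∑ i, (L i : ℝ) * t i = 1 := by
  have hrel := X.mem_dualPic_iff.1 (maximalFace_subset_dualPic hm ht)
  have hpos := maximum_pos hn hm hs ht
  obtain ⟨σ, hσ, -⟩ := X.complete 0
  refine le_antisymm ?_ ?_
  · rw [← sum_coeff_mul hrel ⟨σ, hσ⟩]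
    exact ht.1.2 _
  · exact le_of_mul_le_mul_left ((mul_one _).trans_le (sum_div_le hs hL ht hrel ht.1.1)) hpos

/-! ### Linear programming duality for `a(L)` -/

/-- The infimum `a(L)` is attained and is the maximum of `∑ t i / m i` over `P̃`. -/
theorem isLeast_adjointSet (hn : 0 < n) (hm : ∀ i, 0 < m i) (hs : X.IsSemiample L)
    (hL : ∀ i, ∃ σ : X.maxCones, 0 < X.coeff L σ i)
    {t₀ : Fin s → ℝ} (ht₀ : t₀ ∈ X.maximalFace m L) :
    IsLeast (X.adjointSet m L) (∑ i, (1 / (m i : ℝ)) * t₀ i) := by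
  constructor
  · refine PointedCone.mem_of_forall_dual X.Eff_fg fun l hl => ?_
    rw [dual_adjoint, sub_nonneg]
    exact sum_div_le hs hL ht₀ (X.mem_dualPic_iff.1 ⟨l, rfl⟩) (X.dual_nonneg_iff.1 hl)
  · intro c hc
    obtain ⟨l, rfl⟩ := maximalFace_subset_dualPic hm ht₀
    have h := X.dual_nonneg_iff.2 ht₀.1.1 _ hc
    rwa [dual_adjoint, sum_mul_eq_one hn hm hs hL ht₀, mul_one, sub_nonneg] at h

/-- The cone generated by `F̃` is the face of `Eff(X)ᵛ` cut out by the class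
`a(L) [L] + [K_X + Δ]`. -/
theorem mem_coneOfMaximalFace_iff (hn : 0 < n) (hm : ∀ i, 0 < m i) (hs : X.IsSemiample L)
    (hL : ∀ i, ∃ σ : X.maxCones, 0 < X.coeff L σ i) (l : Dual ℝ X.PicR) :
    l ∈ X.coneOfMaximalFace m L ↔
      (∀ x ∈ X.Eff, 0 ≤ l x) ∧ l (X.adjointClass m L) = 0 := by
  obtain ⟨t₀, ht₀⟩ := maximalFace_nonempty m hs hL
  rw [adjointClass, dual_adjoint, dual_nonneg_iff, a, (isLeast_adjointSet hn hm hs hL ht₀).csInf_eq,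
    sub_eq_zero, coneOfMaximalFace, PointedCone.mem_comap]
  have hrel : ∑ i, X.dualIncl l i • X.rayR i = 0 := X.mem_dualPic_iff.1 ⟨l, rfl⟩
  generalize X.dualIncl l = t at hrel
  constructor
  · intro h
    clear hrel
    induction h using Submodule.span_induction with
    | mem t ht =>
      refine ⟨ht.1.1, ?_⟩
      rw [sum_mul_eq_one hn hm hs hL ht, mul_one]
      exact le_antisymm (ht.2 _ ht₀.1) (ht₀.2 _ ht.1)
    | zero => simp
    | add t t' _ _ h h' =>
      refine ⟨fun i => add_nonneg (h.1 i) (h'.1 i), ?_⟩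
      simp only [Pi.add_apply, mul_add, Finset.sum_add_distrib, h.2, h'.2]
    | smul c t _ h =>
      refine ⟨fun i => mul_nonneg c.2 (h.1 i), ?_⟩
      change _ * ∑ i, (L i : ℝ) * ((c : ℝ) * t i) = ∑ i, (1 / (m i : ℝ)) * ((c : ℝ) * t i)
      simp only [mul_left_comm _ (c : ℝ), ← Finset.mul_sum, h.2]
  · rintro ⟨ht0, h⟩
    rcases (sum_mul_nonneg hs hrel ht0).eq_or_lt with h0 | hpos
    · rw [eq_zero_of_sum_mul_eq_zero hs hL hrel ht0 h0.symm]
      exact Submodule.zero_mem _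
    · rw [← smul_inv_smul₀ hpos.ne' t]
      refine PointedCone.smul_mem _ hpos.le (Submodule.subset_span
        ⟨inv_smul_mem_polytope hrel ht0 hpos, fun t' ht' => (ht₀.2 t' ht').trans_eq ?_⟩)
      simp only [Pi.smul_apply, smul_eq_mul, mul_left_comm _ (∑ i, (L i : ℝ) * t i)⁻¹,
        ← Finset.mul_sum]
      rw [← h, mul_comm, mul_inv_cancel_right₀ hpos.ne']

theorem finrank_span_coneOfMaximalFace (hm : ∀ i, 0 < m i) :
    finrank ℝ (Submodule.span ℝ (X.coneOfMaximalFace m L : Set (Dual ℝ X.PicR))) =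
      finrank ℝ (Submodule.span ℝ (X.maximalFace m L)) := by
  have hmap : (Submodule.span ℝ (X.coneOfMaximalFace m L : Set (Dual ℝ X.PicR))).map X.dualIncl =
      Submodule.span ℝ (X.maximalFace m L) := by
    rw [Submodule.map_span]
    refine le_antisymm (Submodule.span_le.2 ?_) (Submodule.span_mono fun t ht => ?_)
    · rintro _ ⟨l, hl, rfl⟩
      exact PointedCone.hull_le_span ℝ (X.maximalFace m L) (PointedCone.mem_comap.1 hl)
    · obtain ⟨l, rfl⟩ := maximalFace_subset_dualPic hm ht
      exact ⟨l, PointedCone.mem_comap.2 (Submodule.subset_span ht), rfl⟩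
  rw [← hmap]
  exact (Submodule.equivMapOfInjective _ X.dualIncl_injective _).finrank_eq

end SmoothCompleteFan

theorem proposition6p10 {n s : ℕ} (hn : 0 < n) (X : SmoothCompleteFan n s)
    (m : Fin s → ℕ) (hm : ∀ i, 0 < m i)
    (hample : X.IsAmple (-SmoothCompleteFan.logCanonical m))
    (L : Fin s → ℚ) (hsemiample : X.IsSemiample L) (hbig : X.IsBig L)
    (hL : ∀ i, ∃ σ : X.maxCones, 0 < X.coeff L σ i) :
    -- `a(L)` is a minimum, and the maximum of the linear function on `P̃` is attained
    IsLeast (X.adjointSet m L) (X.a m L) ∧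
    (X.maximalFace m L).Nonempty ∧
    -- `F̃` lies in the dual space `H̃` of `Pic(X)_ℝ`
    X.maximalFace m L ⊆ X.dualPic ∧
    -- there is a smallest face of `Eff(X)` that contains `a(L) [L] + [K_X + Δ]`
    IsLeast {G : PointedCone ℝ X.PicR | G.IsFaceOf X.Eff ∧ X.adjointClass m L ∈ G}
      (minimalFace X.Eff (X.adjointClass m L)) ∧
    -- the cone generated by `F̃` is the face dual to it
    AreDualFaces X.Eff (minimalFace X.Eff (X.adjointClass m L)) (X.coneOfMaximalFace m L) ∧
    -- `b(L) = dim F̃ + 1`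
    X.b m L = affineDim (X.maximalFace m L) + 1 := by
  obtain ⟨t₀, ht₀⟩ := SmoothCompleteFan.maximalFace_nonempty m hsemiample hL
  have hleast : IsLeast (X.adjointSet m L) (X.a m L) := by
    have h := SmoothCompleteFan.isLeast_adjointSet hn hm hsemiample hL ht₀
    rwa [← h.csInf_eq] at h
  have hmem : X.adjointClass m L ∈ X.Eff := hleast.1
  have hcone := SmoothCompleteFan.mem_coneOfMaximalFace_iff hn hm hsemiample hL
  refine ⟨hleast, ⟨t₀, ht₀⟩, SmoothCompleteFan.maximalFace_subset_dualPic hm,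
    isLeast_minimalFace hmem, areDualFaces_minimalFace X.Eff_fg hmem hcone, ?_⟩
  rw [SmoothCompleteFan.b, finrank_quotient_span_minimalFace X.Eff_fg hmem hcone,
    SmoothCompleteFan.finrank_span_coneOfMaximalFace hm]
  refine finrank_span_eq_affineDim_add_one ⟨t₀, ht₀⟩
    (∑ i, (L i : ℝ) • LinearMap.proj i) fun t ht => ?_
  rw [← SmoothCompleteFan.sum_mul_eq_one hn hm hsemiample hL ht]
  simp
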